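/- An \emph{abelian processor} with input alphabet $I$, state space $Q$ and output alphabets $(A_u)_{u\in U}$ consists of pairwise commuting maps $t_a:Q\to Q$ ($a\in I$) and message functions $o_a^u:Q\to A_u^*$ such that input words that agree up to permutation, read from the same state, produce outputs that agree up to permutation for each $u$. An \emph{abelian network} $\mathcal N$ on a directed graph $G=(V,E)$ (loops allowed) assigns to each $v\in V$ an abelian processor with input alphabet $A_v$, state space $Q_v$ and output alphabets $(A_u)_{(v,u)\in E}$. Put $A=\bigsqcup_v A_v$ and $Q=\prod_v Q_v$. Processing a letter $a\in A_v$ in the configuration $\mathbf x.\mathbf q\in\mathbb Z^A\times Q$ removes one $a$ from $\mathbf x$, adds the letters of the words $o_a^u(\mathbf q_v)$, and replaces $\mathbf q_v$ by $t_a(\mathbf q_v)$. A word $w\in A^*$ is a \emph{legal} execution for $\mathbf x.\mathbf q$ if each of its letters is present (with count at least $1$) when it is processed, and \emph{complete} if the final letter vector is $\le \mathbf 0$. $\mathcal N$ is \emph{finite} if $V$ and all $A_v$, $Q_v$ are finite, and \emph{halts on all inputs} if each $\mathbf x.\mathbf q$ with $\mathbf x\in\mathbb N^A$, $\mathbf q\in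 Q$ has a complete legal execution; the final state $\mathbf x\rhd\!\rhd\mathbf q$ does not depend on which one is chosen. For a commutative monoid $M$ of self-maps of a set $X$, the action is \emph{irreducible} if $X\ne\emptyset$ and for all $x,x'\in X$ there are $m,m'\in M$ with $mx=m'x'$; if $M$ is finite, its \emph{minimal idempotent} is the unique idempotent $e\in M$ with $e\in Mm$ for all $m\in M$. Let $M_v=\langle t_a\rangle_{a\in A_v}$ with minimal idempotent $e_v$; $\mathcal N$ is \emph{irreducible} if each $M_v$ acts irreducibly on $Q_v$. A state $\mathbf q$ is \emph{locally recurrent} if $\mathbf q_v\in e_vQ_v$ for all $v$, and \emph{recurrent} if $\mathbf q\in eQ$, where $e$ is the minimal idempotent of the monoid generated by the maps $\mathbf q\mapsto 1_a\rhd\!\rhd\mathbf q$, $a\in A$. Each $t_a$, $a\in A_v$, permutes $e_vQ_v$; let $K_v$ be the kernel of the resulting action of $\mathbb Z^{A_v}$ on $e_vQ_v$, let $K=\prod_v K_v\subseteq\mathbb Z^A$ and $r_a=\min\{m\ge1: m1_a\in K\}$. For $\mathbf k\in K\cap\mathbb N^A$ and a locally recurrent $\mathbf q$, let $P_{\mathbf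 q}(\mathbf k)\in\mathbb N^A$ count the letters sent when a word with $\mathbf k_a$ letters $a$ for each $a\in A$ is processed starting from $\mathbf q$ (which returns the network to $\mathbf q$). For irreducible $\mathcal N$ this does not depend on $\mathbf q$; write $P=P_{\mathbf q}$. The \emph{production matrix} $P\in\mathbb Q^{A\times A}$ has entries $P_{ba}=\frac1{r_a}P(r_a1_a)_b$. Let $D=\mathrm{diag}(r_a)$ and $L=(I-P)D$. The \emph{production graph} $\Gamma$ has vertex set $A$ and an edge from $a$ to $b$ whenever $P_{ba}>0$. The \emph{sandpilization} $\mathcal S(\mathcal N)$ is the network on $\Gamma$ in which $a\in A$ has a one-letter alphabet $\{a\}$ and state space $\mathbb Z/r_a\mathbb Z$, each letter increases the state by $1$, and on passing from $r_a-1$ to $0$ the processor at $a$ sends $r_aP_{ba}$ letters $b$ to each $b$. \textbf{Theorem.} Let $\mathcal N$ be a finite irreducible abelian network that halts on all inputs. The following are equivalent. (1) Every locally recurrent state of $\mathcal N$ is recurrent. (2) $\det L=\det D$. (3) Every state of $\mathcal S(\mathcal N)$ is recurrent. (4) The state $\mathbf 0$ of $\mathcal S(\mathcal N)$ is recurrent.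 (5) The production graph $\Gamma$ has no directed cycle (a loop counts as a cycle). (6) The production matrix $P$ is nilpotent. -/

import Mathlib

/-! ### Actions of a monoid of self-maps -/

/-- `e` is the minimal idempotent of the (commutative) monoid `M` of self-maps of `X`: the
idempotent of `M` that is accessible from all of `M`, i.e. `e ∈ M m` for every `m ∈ M`. -/
def IsMinimalIdempotent {X : Type*} (M : Submonoid (Function.End X)) (e : Function.End X) : Prop :=
  e ∈ M ∧ e * e = e ∧ ∀ m ∈ M, ∃ m' ∈ M, m' * m = e

/-- The set `e X` of recurrent elements, where `e` is the minimal idempotent of `M`. -/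
def recurrentSet {X : Type*} (M : Submonoid (Function.End X)) : Set X :=
  {x | ∃ e : Function.End X, IsMinimalIdempotent M e ∧ ∃ y : X, e y = x}

/-- The action of `M` on `X` is irreducible: the relation `∃ m m' ∈ M, m x = m' x'` has exactly
one equivalence class. -/
def IsIrreducibleAction {X : Type*} (M : Submonoid (Function.End X)) : Prop :=
  Nonempty X ∧ ∀ x x' : X, ∃ m ∈ M, ∃ m' ∈ M, m x = m' x'

/-! ### Processors -/

/-- An automaton with output: input alphabet `I`, states `Q`, output alphabets `B u`, `u : U`. -/
structure Processor (I Q : Type*) {U : Type*} (B : U → Type*) where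
  /-- state transition maps -/
  t : I → Q → Q
  /-- message passing functions -/
  o : I → (u : U) → Q → List (B u)

namespace Processor

variable {I Q U : Type*} {B : U → Type*}

/-- The state reached from `q` after reading the word `w`. -/
def run (p : Processor I Q B) : List I → Q → Q
  | [], q => q
  | a :: w, q => run p w (p.t a q)

/-- The word sent to the feed `u` when the word `w` is read starting from `q`. -/
def output (p : Processor I Q B) (u : U) : List I → Q → List (B u)
  | [], _ => []
  | a :: w, q => p.o a u q ++ output p u w (p.t a q)

/-- The transition monoid `⟨t_a⟩ ⊆ End Q`. -/
def transitionMonoid (p : Processor I Q B) : Submonoid (Function.End Q) :=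
  Submonoid.closure {f | ∃ a : I, f = p.t a}

end Processor

/-- An abelian processor with output. -/
structure AbelianProcessor (I Q : Type*) {U : Type*} (B : U → Type*) extends
    Processor I Q B where
  t_comm : ∀ (a b : I) (q : Q), t a (t b q) = t b (t a q)
  output_perm : ∀ (w w' : List I), w.Perm w' → ∀ (q : Q) (u : U),
    (toProcessor.output u w q).Perm (toProcessor.output u w' q)

namespace AbelianProcessor

variable {I Q U : Type*} {B : U → Type*}

theorem run_append (p : AbelianProcessor I Q B) (w w' : List I) (q : Q) :
    p.run (w ++ w') q = p.run w' (p.run w q) := by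
  induction w generalizing q with
  | nil => rfl
  | cons a w ih => exact ih _

theorem comm_t (p : AbelianProcessor I Q B) {m : Function.End Q} (hm : m ∈ p.transitionMonoid)
    (a : I) (q : Q) : p.t a (m q) = m (p.t a q) := by
  induction hm using Submonoid.closure_induction generalizing q with
  | mem f hf => obtain ⟨b, rfl⟩ := hf; exact p.t_comm a b q
  | one => rfl
  | mul f g _ _ hf hg =>
    change p.t a (f (g q)) = f (g (p.t a q))
    rw [hf, hg]

theorem comm_run (p : AbelianProcessor I Q B) {m : Function.End Q} (hm : m ∈ p.transitionMonoid)
    (w : List I) (q : Q) : p.run w (m q) = m (p.run w q) := by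
  induction w generalizing q with
  | nil => rfl
  | cons a w ih =>
    change p.run w (p.t a (m q)) = m (p.run w (p.t a q))
    rw [p.comm_t hm, ih]

theorem run_mem_recurrentSet (p : AbelianProcessor I Q B) (w : List I) {q : Q}
    (hq : q ∈ recurrentSet p.transitionMonoid) :
    p.run w q ∈ recurrentSet p.transitionMonoid := by
  obtain ⟨e, he, y, rfl⟩ := hq
  exact ⟨e, he, p.run w y, (p.comm_run he.1 w y).symm⟩

/-- The kernel `K_v ⊆ ℤ^I` of the action of `ℤ^I` on the recurrent set `e Q`. Every letter acts
on `e Q` as a permutation, and `|w| - |w'|` acts as `t_w t_{w'}⁻¹`; so a vector acts trivially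
exactly when it is `|w| - |w'|` for words `w`, `w'` with the same action on `e Q`. -/
def kernel [DecidableEq I] (p : AbelianProcessor I Q B) : AddSubgroup (I → ℤ) where
  carrier := {x | ∃ w w' : List I, (∀ a, x a = (w.count a : ℤ) - (w'.count a : ℤ)) ∧
    ∀ q ∈ recurrentSet p.transitionMonoid, p.run w q = p.run w' q}
  zero_mem' := ⟨[], [], by simp, fun _ _ => rfl⟩
  add_mem' := by
    rintro x y ⟨w, w', hx, hw⟩ ⟨z, z', hy, hz⟩
    refine ⟨w ++ z, w' ++ z', fun a => ?_, fun q hq => ?_⟩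
    · simp only [Pi.add_apply, hx, hy, List.count_append]
      push_cast
      ring
    · rw [run_append, run_append, hw q hq]
      exact hz _ (p.run_mem_recurrentSet w' hq)
  neg_mem' := by
    rintro x ⟨w, w', hx, hw⟩
    exact ⟨w', w, fun a => by simp [hx], fun q hq => (hw q hq).symm⟩

end AbelianProcessor

/-! ### Networks -/

/-- An abelian network with vertices `V`, alphabets `A v` and state spaces `Q v`. The total
alphabet is `Σ v, A v`, and a state of the network is an element of `∀ v, Q v`. -/
structure AbelianNetwork (V : Type*) (A Q : V → Type*) where
  /-- the underlying directed graph (loops are allowed) -/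
  graph : Digraph V
  proc : ∀ v, AbelianProcessor (A v) (Q v) A
  /-- messages are only sent along edges -/
  message_nil : ∀ v u, ¬ graph.Adj v u → ∀ (a : A v) (q : Q v), (proc v).o a u q = []

namespace AbelianNetwork

variable {V : Type*} {A Q : V → Type*} [DecidableEq V] [∀ v, DecidableEq (A v)]

/-- Process the letter `a` in the configuration `x.q`, where `x` counts the waiting letters. -/
def step (N : AbelianNetwork V A Q) (a : Σ v, A v) (s : ((Σ v, A v) → ℤ) × (∀ v, Q v)) :
    ((Σ v, A v) → ℤ) × (∀ v, Q v) :=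
  (fun b => s.1 b - (if b = a then 1 else 0)
      + ((((N.proc a.1).o a.2 b.1 (s.2 a.1)).count b.2 : ℕ) : ℤ),
    Function.update s.2 a.1 ((N.proc a.1).t a.2 (s.2 a.1)))

/-- The result `π_w(x.q)` of executing the word `w`. -/
def exec (N : AbelianNetwork V A Q) :
    List (Σ v, A v) → ((Σ v, A v) → ℤ) × (∀ v, Q v) → ((Σ v, A v) → ℤ) × (∀ v, Q v)
  | [], s => s
  | a :: w, s => exec N w (N.step a s)

/-- The word is legal: each letter is present when it is processed. -/
def IsLegal (N : AbelianNetwork V A Q) :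
    List (Σ v, A v) → ((Σ v, A v) → ℤ) × (∀ v, Q v) → Prop
  | [], _ => True
  | a :: w, s => 1 ≤ s.1 a ∧ IsLegal N w (N.step a s)

/-- The word is complete: no letters remain after its execution. -/
def IsComplete (N : AbelianNetwork V A Q) (w : List (Σ v, A v))
    (s : ((Σ v, A v) → ℤ) × (∀ v, Q v)) : Prop :=
  (N.exec w s).1 ≤ 0

/-- `x.q` has a complete legal execution. -/
def HaltsOn (N : AbelianNetwork V A Q) (x : (Σ v, A v) → ℕ) (q : ∀ v, Q v) : Prop :=
  ∃ w : List (Σ v, A v), N.IsLegal w (fun a => (x a : ℤ), q) ∧ N.IsComplete w (fun a => (x a : ℤ), q)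

/-- The network halts on all inputs. -/
def HaltsOnAllInputs (N : AbelianNetwork V A Q) : Prop :=
  ∀ (x : (Σ v, A v) → ℕ) (q : ∀ v, Q v), N.HaltsOn x q

open Classical in
/-- The global action `x ▷▷ q`: the final state of a complete legal execution of `x.q` (the same
for all of them). The value is only meaningful when the network halts on `x.q`. -/
noncomputable def globalAct (N : AbelianNetwork V A Q) (x : (Σ v, A v) → ℕ) (q : ∀ v, Q v) :
    ∀ v, Q v :=
  if h : N.HaltsOn x q then (N.exec h.choose (fun a => (x a : ℤ), q)).2 else q

/-- The global monoid, generated by the maps `τ_a : q ↦ 1_a ▷▷ q`. -/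
noncomputable def globalMonoid (N : AbelianNetwork V A Q) : Submonoid (Function.End (∀ v, Q v)) :=
  Submonoid.closure {f | ∃ a : Σ v, A v, f = fun q => N.globalAct (Pi.single a 1) q}

/-- `q = e q` for the minimal idempotent `e` of the global monoid. -/
def IsRecurrent (N : AbelianNetwork V A Q) (q : ∀ v, Q v) : Prop :=
  q ∈ recurrentSet N.globalMonoid

/-- `q_v ∈ e_v Q_v` for all `v`, where `e_v` is the minimal idempotent of the local monoid. -/
def IsLocallyRecurrent (N : AbelianNetwork V A Q) (q : ∀ v, Q v) : Prop :=
  ∀ v, q v ∈ recurrentSet (N.proc v).transitionMonoid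

/-- Every processor of the network is irreducible. -/
def IsIrreducible (N : AbelianNetwork V A Q) : Prop :=
  ∀ v, IsIrreducibleAction (N.proc v).transitionMonoid

/-- The total kernel `K = ∏ K_v ⊆ ℤ^A`. -/
def totalKernel (N : AbelianNetwork V A Q) : AddSubgroup ((Σ v, A v) → ℤ) where
  carrier := {x | ∀ v, (fun a : A v => x ⟨v, a⟩) ∈ (N.proc v).kernel}
  zero_mem' := fun v => (N.proc v).kernel.zero_mem
  add_mem' := fun hx hy v => (N.proc v).kernel.add_mem (hx v) (hy v)
  neg_mem' := fun hx v => (N.proc v).kernel.neg_mem (hx v)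

/-- The reset number `r_a = min {m ≥ 1 : m 1_a ∈ K}`. -/
noncomputable def resetNumber (N : AbelianNetwork V A Q) (a : Σ v, A v) : ℕ :=
  sInf {m : ℕ | 1 ≤ m ∧ Pi.single a (m : ℤ) ∈ N.totalKernel}

/-- The local action `|w| ▷ q = π_w(|w|.q)`: the letters of `w` are added and processed. -/
def localAct (N : AbelianNetwork V A Q) (w : List (Σ v, A v)) (q : ∀ v, Q v) :
    ((Σ v, A v) → ℤ) × (∀ v, Q v) :=
  N.exec w (fun b => (w.count b : ℤ), q)

/-- The matrix of the production map `P_q`, for a locally recurrent state `q` (on which it does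
not depend if the network is irreducible). For `k ∈ K ∩ ℕ^A` one has `k ▷ q = P_q(k).q`, and
column `a` is `P_q(1_a) = (1 / r_a) P_q(r_a 1_a)`. -/
noncomputable def productionMatrix (N : AbelianNetwork V A Q) (q : ∀ v, Q v) :
    Matrix (Σ v, A v) (Σ v, A v) ℚ :=
  Matrix.of fun b a =>
    ((N.localAct (List.replicate (N.resetNumber a) a) q).1 b : ℚ) / (N.resetNumber a : ℚ)

/-- The diagonal matrix `D` of reset numbers. -/
noncomputable def resetMatrix (N : AbelianNetwork V A Q) : Matrix (Σ v, A v) (Σ v, A v) ℚ :=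
  Matrix.diagonal fun a => (N.resetNumber a : ℚ)

/-- The Laplacian `L = (I - P) D`. -/
noncomputable def laplacian [Fintype V] [∀ v, Fintype (A v)] (N : AbelianNetwork V A Q)
    (q : ∀ v, Q v) : Matrix (Σ v, A v) (Σ v, A v) ℚ :=
  (1 - N.productionMatrix q) * N.resetMatrix

/-- The production graph: there is an edge from `a` to `b` when `P_{ba} > 0`. -/
def productionGraph (N : AbelianNetwork V A Q) (q : ∀ v, Q v) : Digraph (Σ v, A v) where
  Adj a b := 0 < N.productionMatrix q b a

/-- The processor of the sandpilization at the letter `a`: it has a single input letter, counts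
modulo `r_a`, and when it passes from `r_a - 1` to `0` it sends `r_a P_{ba}` letters to each `b`. -/
noncomputable def sandpileProcessor (N : AbelianNetwork V A Q) (q : ∀ v, Q v) (a : Σ v, A v) :
    AbelianProcessor Unit (ZMod (N.resetNumber a)) (fun _ : (Σ v, A v) => Unit) where
  t := fun _ s => s + 1
  o := fun _ b s =>
    if s + 1 = 0 then
      List.replicate ⌊(N.resetNumber a : ℚ) * N.productionMatrix q b a⌋₊ ()
    else []
  t_comm := fun _ _ _ => rfl
  output_perm := fun w w' h s u => by
    have : w = w' := List.ext_getElem h.length_eq fun _ _ _ => rfl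
    rw [this]

/-- The sandpilization of the network, a unary network on the production graph. -/
noncomputable def sandpilization (N : AbelianNetwork V A Q) (q : ∀ v, Q v) :
    AbelianNetwork (Σ v, A v) (fun _ => Unit) (fun a => ZMod (N.resetNumber a)) where
  graph := N.productionGraph q
  proc := N.sandpileProcessor q
  message_nil := fun a b hab _ s => by
    have h : (N.resetNumber a : ℚ) * N.productionMatrix q b a ≤ 0 :=
      mul_nonpos_of_nonneg_of_nonpos (Nat.cast_nonneg _) (not_lt.mp hab)
    simp [sandpileProcessor, Nat.floor_of_nonpos h]

end AbelianNetwork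

/-- The digraph has a directed cycle `a_1 → ⋯ → a_m → a_1`, `m ≥ 1`, with distinct vertices. -/
def Digraph.HasDirectedCycle {W : Type*} (G : Digraph W) : Prop :=
  ∃ c : Cycle W, c ≠ Cycle.nil ∧ c.Nodup ∧ c.Chain G.Adj

/-! ### The locally recurrent states and the reset numbers exist -/

theorem exists_pow_idem {M : Type*} [Monoid M] [Finite M] (z : M) :
    ∃ n, z ^ (n + 1) * z ^ (n + 1) = z ^ (n + 1) := by
  obtain ⟨i, j, hne, hij⟩ := Finite.exists_ne_map_eq_of_infinite (fun n : ℕ => z ^ n)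
  wlog hlt : i < j generalizing i j with H
  · exact H j i hne.symm hij.symm (lt_of_le_of_ne (not_lt.mp hlt) hne.symm)
  obtain ⟨p, rfl⟩ := Nat.exists_eq_add_of_lt hlt
  have key : ∀ k m, i ≤ m → z ^ (m + k * (p + 1)) = z ^ m := by
    intro k m hm
    induction k with
    | zero => simp
    | succ k ih =>
      obtain ⟨d, rfl⟩ := Nat.exists_eq_add_of_le hm
      rw [← ih, show i + d + (k + 1) * (p + 1) = (i + p + 1) + (d + k * (p + 1)) by ring,
        pow_add, ← hij, ← pow_add]
      congr 1
      ring
  refine ⟨i * (p + 1) + p, ?_⟩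
  rw [← pow_add]
  have := key (i + 1) ((i + 1) * (p + 1)) (by nlinarith)
  convert this using 2 <;> ring

namespace AbelianProcessor
variable {I Q U : Type*} {B : U → Type*}

theorem exists_minimalIdempotent [Finite Q] (p : AbelianProcessor I Q B) :
    ∃ e, IsMinimalIdempotent p.transitionMonoid e := by
  have hc : ∀ a ∈ {f : Function.End Q | ∃ a : I, f = p.t a},
      ∀ b ∈ {f : Function.End Q | ∃ a : I, f = p.t a}, a * b = b * a := by
    rintro _ ⟨a, rfl⟩ _ ⟨b, rfl⟩
    exact funext fun q => p.t_comm a b q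
  have hi : IsMulCommutative p.transitionMonoid :=
    Submonoid.isMulCommutative_closure (Function.End Q) hc
  let _ : CommMonoid p.transitionMonoid :=
    { (inferInstance : Monoid p.transitionMonoid) with mul_comm := hi.is_comm.comm }
  have : Finite (Function.End Q) := inferInstanceAs (Finite (Q → Q))
  have : Fintype p.transitionMonoid := Fintype.ofFinite _
  obtain ⟨n, hn⟩ := exists_pow_idem (∏ m : p.transitionMonoid, m)
  set z := ∏ m : p.transitionMonoid, m with hz
  refine ⟨(z ^ (n + 1) : p.transitionMonoid), (z ^ (n + 1)).2, congrArg Subtype.val hn, ?_⟩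
  intro m hm
  obtain ⟨c, hcz⟩ := Finset.dvd_prod_of_mem (fun m : p.transitionMonoid => m)
    (Finset.mem_univ ⟨m, hm⟩)
  refine ⟨(z ^ n * c : p.transitionMonoid), (z ^ n * c).2, ?_⟩
  have : z ^ n * c * ⟨m, hm⟩ = z ^ (n + 1) := by
    rw [pow_succ, mul_assoc, mul_comm c, ← hcz]
  exact congrArg Subtype.val this

end AbelianProcessor

/-- Locally recurrent states exist. -/
theorem AbelianNetwork.exists_isLocallyRecurrent {V : Type*} {A Q : V → Type*}
    [∀ v, Finite (Q v)] (N : AbelianNetwork V A Q) (h : N.IsIrreducible) :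
    ∃ q, N.IsLocallyRecurrent q := by
  choose e he using fun v => (N.proc v).exists_minimalIdempotent
  exact ⟨fun v => e v (h v).1.some, fun v => ⟨e v, he v, (h v).1.some, rfl⟩⟩

/-- The set whose minimum is the reset number is nonempty. -/
theorem AbelianNetwork.one_le_resetNumber {V : Type*} {A Q : V → Type*} [DecidableEq V] [∀ v, DecidableEq (A v)]
    [∀ v, Finite (Q v)] (N : AbelianNetwork V A Q) (a : Σ v, A v) : 1 ≤ N.resetNumber a := by
  refine (Nat.sInf_mem (s := {m : ℕ | 1 ≤ m ∧ Pi.single a (m : ℤ) ∈ N.totalKernel}) ?_).1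
  obtain ⟨v, a⟩ := a
  obtain ⟨e, he⟩ := (N.proc v).exists_minimalIdempotent
  have : Finite (Function.End (Q v)) := inferInstanceAs (Finite (Q v → Q v))
  set T : Function.End (Q v) := (N.proc v).t a
  obtain ⟨n, hn⟩ := exists_pow_idem T
  have hT : T ∈ (N.proc v).transitionMonoid := Submonoid.subset_closure ⟨a, rfl⟩
  have hrun : ∀ k q, (N.proc v).run (List.replicate k a) q = (T ^ k) q := by
    intro k
    induction k with
    | zero => intro q; rfl
    | succ k ih => intro q; exact (ih _)
  refine ⟨n + 1, by omega, fun w => ?_⟩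
  by_cases hw : w = v
  · subst hw
    refine ⟨List.replicate (n + 1) a, [], fun b => ?_, ?_⟩
    · by_cases hb : a = b
      · subst hb; simp
      · simp [List.count_replicate, hb]
    · rintro _ ⟨f, hf, y, rfl⟩
      rw [hrun]
      obtain ⟨m', hm', hm⟩ := hf.2.2 _ (Submonoid.pow_mem _ hT (n + 1))
      change (T ^ (n + 1)) (f y) = f y
      have h1 : T ^ (n + 1) * f = f := by
        have hcomm : T ^ (n + 1) * f = f * T ^ (n + 1) := by
          funext q
          have := (N.proc w).comm_run hf.1 (List.replicate (n + 1) a) q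
          rw [hrun, hrun] at this
          exact this
        rw [hcomm]; nth_rw 1 [← hm]; rw [mul_assoc, hn, hm]
      exact congrFun h1 y
  · convert (N.proc w).kernel.zero_mem using 1
    funext b
    exact Pi.single_eq_of_ne (fun h => hw (congrArg Sigma.fst h)) _

/-!
Reading `r_a` letters `a` returns a locally recurrent state to itself and sends column `a` of the
integer matrix `P D`, and the sandpilization does the same with all of its states. Halting gives a
vector `k` of natural numbers with `P D k < D k` in every coordinate.

If `Γ` has no cycle, feed the network the positive input `D k - P D k`. A word with letter vector
`D k` uses it up exactly and returns to the initial state. Were some of this word not processed, it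
would contain a letter with no predecessor in `Γ` among the rest, and that letter could not be
missing. So the positive input fixes the state, which is therefore recurrent. Conversely, if `Γ` has
a cycle, then on a chordless one some state has each letter about to send the next letter.
Processing every letter of the cycle once leads to a state that is not recurrent: a legal execution
returning to it could be shortened by the cycle, against the least action principle.

As for the determinant, `u = D k` satisfies `P u < u`, so that `G = (1 - P)⁻¹` is nonnegative, and
`0 < det (1 - P) ≤ 1`. Replacing row `i` of `P` by zero multiplies `det (1 - P)` by `G_ii`, and the
bound still holds for the new matrix. Hence `det (1 - P) = 1` forces `G_ii = 1` for all `i`, which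
says that no cycle passes through `i`.
-/

/-! ### Words and finite relations -/

theorem exists_list_count_eq {α : Type*} [DecidableEq α] [Finite α] (c : α → ℕ) :
    ∃ w : List α, ∀ a, w.count a = c a := by
  refine ⟨(Finsupp.toMultiset (Finsupp.equivFunOnFinite.symm c)).toList, fun a => ?_⟩
  rw [← Multiset.coe_count, Multiset.coe_toList, Finsupp.count_toMultiset,
    Finsupp.equivFunOnFinite_symm_apply_apply]

theorem count_cons_eq_single_add {α : Type*} [DecidableEq α] (a : α) (w : List α) :
    (fun b => (a :: w).count b) = Pi.single a 1 + fun b => w.count b := by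
  funext b
  rcases eq_or_ne a b with rfl | hab
  · simp [add_comm]
  · simp [hab, hab.symm]

section FiniteRelation

variable {α : Type*} [Finite α] {r : α → α → Prop}

-- A minimal nonempty set in which every element has a predecessor works: by minimality every
-- choice of predecessors is surjective, hence injective, which leaves no freedom in the choice.
theorem exists_equiv_rel_iff_of_not_wellFounded (h : ¬ WellFounded r) :
    ∃ (C : Set α) (p : C ≃ C), C.Nonempty ∧ ∀ a b : C, r a b ↔ a = p b := by
  classical
  obtain ⟨C, ⟨hne, hpred⟩, hmin⟩ : ∃ C : Set α, Minimal
      (fun C : Set α => C.Nonempty ∧ ∀ b : C, ∃ a : C, r a b) C := by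
    refine exists_minimal_of_wellFoundedLT _ ?_
    simpa [WellFounded.wellFounded_iff_has_min] using h
  have hbij (f : C → C) (hf : ∀ b, r (f b) b) : f.Bijective := by
    refine Function.Surjective.bijective_of_finite fun c => ?_
    have himage : C ⊆ Subtype.val '' Set.range f := by
      refine hmin ⟨((Set.range_nonempty_iff_nonempty.2 hne.to_subtype).image _), ?_⟩
        (Subtype.coe_image_subset _ _)
      rintro ⟨_, _, ⟨b, rfl⟩, rfl⟩
      exact ⟨⟨f (f b), _, ⟨f b, rfl⟩, rfl⟩, hf (f b)⟩
    simpa using himage c.2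
  choose p hp using hpred
  refine ⟨C, Equiv.ofBijective p (hbij p hp), hne, fun a b => ⟨fun hab => ?_, ?_⟩⟩
  · obtain ⟨c, rfl⟩ := (hbij p hp).2 a
    by_contra hcb
    have hne : c ≠ b := fun h => hcb (congrArg p h)
    have hupdate := hbij (Function.update p b (p c)) fun d => by
      rcases eq_or_ne d b with rfl | hd
      · rwa [Function.update_self]
      · rw [Function.update_of_ne hd]
        exact hp d
    refine hne (hupdate.1 ?_)
    rw [Function.update_self, Function.update_of_ne hne]
  · rintro rfl
    exact hp b

theorem not_hasDirectedCycle_iff_wellFounded_adj (G : Digraph α) :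
    ¬ G.HasDirectedCycle ↔ WellFounded G.Adj := by
  constructor
  · contrapose!
    intro h
    obtain ⟨C, p, ⟨x, hx⟩, hp⟩ := exists_equiv_rel_iff_of_not_wellFounded h
    have hper : (⟨x, hx⟩ : C) ∈ Function.periodicPts p.symm := p.symm.injective.mem_periodicPts _
    refine ⟨(Function.periodicOrbit p.symm ⟨x, hx⟩).map Subtype.val, ?_, ?_, ?_⟩
    · rwa [Ne, Cycle.map_eq_nil, Function.periodicOrbit_eq_nil_iff_not_periodic_pt, not_not]
    · have hnodup := Function.nodup_periodicOrbit (f := p.symm) (x := ⟨x, hx⟩)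
      revert hnodup
      induction Function.periodicOrbit p.symm ⟨x, hx⟩ using Quotient.inductionOn with
      | _ l => exact List.Nodup.map Subtype.val_injective
    · rw [Cycle.chain_map, Function.periodicOrbit_chain' _ hper]
      intro n
      rw [Function.iterate_succ_apply', hp, Equiv.apply_symm_apply]
  · rintro hwf ⟨c, hc, -, hchain⟩
    obtain ⟨a, ha⟩ : ∃ a, a ∈ c := by
      induction c using Cycle.induction_on with
      | nil => exact absurd rfl hc
      | cons a l _ => exact ⟨a, by simp⟩
    have htrans := Cycle.chain_iff_pairwise.1
      (hchain.imp fun _ _ => Relation.TransGen.single)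
    exact hwf.transGen.irrefl.irrefl a (htrans a ha a ha)

theorem exists_natRank_of_wellFounded (h : WellFounded r) : ∃ f : α → ℕ, ∀ a b, r a b → f a < f b :=
  ⟨fun b => {a | Relation.TransGen r a b}.ncard, fun a _ hab => Set.ncard_lt_ncard
    ⟨fun _ hca => hca.tail hab, fun hsub => h.transGen.irrefl.irrefl a (hsub (.single hab))⟩⟩

end FiniteRelation

/-! ### Nonnegative matrices -/

section NonnegativeMatrix

open Matrix

variable {n : Type*} [Fintype n] [DecidableEq n]

theorem pow_apply_eq_zero_of_natRank {K : Type*} [Semiring K] {P : Matrix n n K} {f : n → ℕ}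
    (hf : ∀ a b, P b a ≠ 0 → f a < f b) {m : ℕ} {b : n} (hb : f b < m) (c : n) :
    (P ^ m) b c = 0 := by
  induction m generalizing b with
  | zero => omega
  | succ m ih =>
    rw [pow_succ', mul_apply]
    refine Finset.sum_eq_zero fun a _ => ?_
    by_cases ha : P b a = 0
    · rw [ha, zero_mul]
    · rw [ih ((hf a b ha).trans_le (Nat.le_of_lt_succ hb)), mul_zero]

theorem isNilpotent_of_wellFounded {K : Type*} [Semiring K] {P : Matrix n n K}
    (h : WellFounded fun a b => P b a ≠ 0) : IsNilpotent P := by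
  obtain ⟨f, hf⟩ := exists_natRank_of_wellFounded h
  exact ⟨Finset.univ.sup f + 1, ext fun b c => pow_apply_eq_zero_of_natRank hf
    (Nat.lt_succ_of_le (Finset.le_sup (Finset.mem_univ b))) c⟩

theorem det_one_sub_of_isNilpotent {K : Type*} [CommRing K] [IsDomain K] {P : Matrix n n K}
    (h : IsNilpotent P) : (1 - P).det = 1 := by
  have hcharpoly := sub_eq_zero.1 (isNilpotent_charpoly_sub_pow_of_isNilpotent h).eq_zero
  simpa [hcharpoly] using (eval_charpoly P 1).symm

variable {K : Type*} [Field K] [LinearOrder K]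

/-- `u` is a strictly subinvariant vector of the nonnegative matrix `P`: it is positive, and
`P u < u` in every entry. It witnesses that the spectral radius of `P` is less than `1`. -/
structure IsStrictlySubinvariant (P : Matrix n n K) (u : n → K) : Prop where
  nonneg : ∀ a b, 0 ≤ P a b
  pos : ∀ a, 0 < u a
  mulVec_lt : ∀ a, (P *ᵥ u) a < u a

namespace IsStrictlySubinvariant

variable {P : Matrix n n K} {u : n → K}

theorem updateRow_zero (h : IsStrictlySubinvariant P u) (i : n) :
    IsStrictlySubinvariant (P.updateRow i 0) u where
  nonneg a b := by
    rcases eq_or_ne a i with rfl | ha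
    · simp
    · simpa [updateRow_ne ha] using h.nonneg a b
  pos := h.pos
  mulVec_lt a := by
    rcases eq_or_ne a i with rfl | ha
    · simpa [mulVec] using h.pos a
    · simpa [mulVec, updateRow_ne ha] using h.mulVec_lt a

variable [IsStrictOrderedRing K]

-- Compare with `u` at a coordinate `b` minimizing `x b / u b`.
theorem nonneg_of_mulVec_nonneg (h : IsStrictlySubinvariant P u) {x : n → K}
    (hx : 0 ≤ (1 - P) *ᵥ x) : 0 ≤ x := by
  intro a
  by_contra! ha
  obtain ⟨b, -, hb⟩ := Finset.exists_min_image Finset.univ (fun c => x c / u c)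
    ⟨a, Finset.mem_univ a⟩
  set t := x b / u b
  have ht : t < 0 := (hb a (Finset.mem_univ a)).trans_lt (div_neg_of_neg_of_pos ha (h.pos a))
  have hux (c : n) : t * u c ≤ x c := (le_div_iff₀ (h.pos c)).1 (hb c (Finset.mem_univ c))
  have hlt : x b < (P *ᵥ x) b := calc
    x b = t * u b := (div_mul_cancel₀ _ (h.pos b).ne').symm
    _ < t * (P *ᵥ u) b := mul_lt_mul_of_neg_left (h.mulVec_lt b) ht
    _ = (P *ᵥ (t • u)) b := by rw [mulVec_smul, Pi.smul_apply, smul_eq_mul]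
    _ ≤ (P *ᵥ x) b := Finset.sum_le_sum fun c _ => mul_le_mul_of_nonneg_left (hux c) (h.nonneg b c)
  have := hx b
  rw [sub_mulVec, one_mulVec, Pi.sub_apply, Pi.zero_apply] at this
  linarith

theorem det_ne_zero (h : IsStrictlySubinvariant P u) : (1 - P).det ≠ 0 := by
  intro hdet
  obtain ⟨x, hx, hx0⟩ := exists_mulVec_eq_zero_iff.2 hdet
  refine hx (le_antisymm ?_ (h.nonneg_of_mulVec_nonneg hx0.ge))
  exact neg_nonneg.1 (h.nonneg_of_mulVec_nonneg (by rw [mulVec_neg, hx0, neg_zero]))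

theorem mul_inv (h : IsStrictlySubinvariant P u) : (1 - P) * (1 - P)⁻¹ = 1 :=
  mul_nonsing_inv _ h.det_ne_zero.isUnit

theorem inv_eq (h : IsStrictlySubinvariant P u) : (1 - P)⁻¹ = 1 + P * (1 - P)⁻¹ := by
  rw [← sub_eq_iff_eq_add]
  simpa only [sub_mul, one_mul] using h.mul_inv

theorem inv_nonneg (h : IsStrictlySubinvariant P u) (a b : n) : 0 ≤ (1 - P)⁻¹ a b := by
  refine h.nonneg_of_mulVec_nonneg (x := (1 - P)⁻¹.col b) (fun c => ?_) a
  change 0 ≤ ((1 - P) * (1 - P)⁻¹) c b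
  rw [h.mul_inv, one_apply]
  split <;> simp

theorem mul_inv_nonneg (h : IsStrictlySubinvariant P u) (a b : n) : 0 ≤ (P * (1 - P)⁻¹) a b :=
  Finset.sum_nonneg fun c _ => mul_nonneg (h.nonneg a c) (h.inv_nonneg c b)

theorem inv_diag_eq (h : IsStrictlySubinvariant P u) (a : n) :
    (1 - P)⁻¹ a a = 1 + (P * (1 - P)⁻¹) a a := by
  conv_lhs => rw [h.inv_eq, Matrix.add_apply, one_apply_eq]

theorem det_updateRow_zero (h : IsStrictlySubinvariant P u) (i : n) :
    (1 - P.updateRow i 0).det = (1 - P).det * (1 - P)⁻¹ i i := by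
  have hrow : 1 - P.updateRow i 0 = (1 - P).updateRow i (Pi.single i 1) := by
    ext a b
    rcases eq_or_ne a i with rfl | ha
    · simp [one_apply, Pi.single_apply, eq_comm]
    · simp [updateRow_ne ha]
  rw [hrow, ← adjugate_apply, inv_def, Matrix.smul_apply, smul_eq_mul, Ring.inverse_eq_inv',
    mul_inv_cancel_left₀ h.det_ne_zero]

-- Zeroing the rows of `P` one by one turns `1 - P` into `1` and never decreases the determinant.
theorem det_mem_Ioc (h : IsStrictlySubinvariant P u) : (1 - P).det ∈ Set.Ioc 0 1 := by
  suffices ∀ (s : Finset n) (P : Matrix n n K), IsStrictlySubinvariant P u →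
      (∀ a ∉ s, P a = 0) → (1 - P).det ∈ Set.Ioc 0 1 from
    this Finset.univ P h fun a ha => absurd (Finset.mem_univ a) ha
  intro s
  induction s using Finset.induction_on with
  | empty =>
    intro P _ hP
    obtain rfl : P = 0 := funext fun a => hP a (Finset.notMem_empty a)
    simp
  | insert i s _ ih =>
    intro P h hP
    obtain ⟨hpos, hle⟩ := ih (P.updateRow i 0) (h.updateRow_zero i) fun a ha => by
      rcases eq_or_ne a i with rfl | hai
      · exact updateRow_self
      · exact (updateRow_ne hai).trans (hP a (by simp [hai, ha]))
    rw [h.det_updateRow_zero] at hpos hle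
    have hdiag : 1 ≤ (1 - P)⁻¹ i i := by
      rw [h.inv_diag_eq]
      exact le_add_of_nonneg_right (h.mul_inv_nonneg i i)
    have hdet : 0 < (1 - P).det := pos_of_mul_pos_left hpos (zero_le_one.trans hdiag)
    exact ⟨hdet, (le_mul_of_one_le_right hdet.le hdiag).trans hle⟩

theorem mul_inv_pos_of_transGen (h : IsStrictlySubinvariant P u) {a b : n}
    (hab : Relation.TransGen (fun a b => 0 < P b a) a b) : 0 < (P * (1 - P)⁻¹) b a := by
  have hstep {c d : n} (hcd : 0 < P d c) (hc : 0 < (1 - P)⁻¹ c a) : 0 < (P * (1 - P)⁻¹) d a :=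
    Finset.sum_pos' (fun e _ => mul_nonneg (h.nonneg d e) (h.inv_nonneg e a))
      ⟨c, Finset.mem_univ c, mul_pos hcd hc⟩
  induction hab with
  | single hab =>
    refine hstep hab ?_
    rw [h.inv_diag_eq]
    exact add_pos_of_pos_of_nonneg one_pos (h.mul_inv_nonneg a a)
  | tail _ hcd ih =>
    refine hstep hcd ?_
    rw [h.inv_eq, Matrix.add_apply, one_apply]
    exact add_pos_of_nonneg_of_pos (by split <;> simp) ih

theorem wellFounded_of_det_eq_one (h : IsStrictlySubinvariant P u) (hdet : (1 - P).det = 1) :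
    WellFounded fun a b => 0 < P b a := by
  have hirrefl : Std.Irrefl (Relation.TransGen fun a b => 0 < P b a) := ⟨fun i hi => by
    have hle := (h.updateRow_zero i).det_mem_Ioc.2
    rw [h.det_updateRow_zero, hdet, one_mul, h.inv_diag_eq, add_le_iff_nonpos_right] at hle
    exact hle.not_gt (h.mul_inv_pos_of_transGen hi)⟩
  exact (Finite.wellFounded_of_trans_of_irrefl (Relation.TransGen fun a b => 0 < P b a)).mono
    fun _ _ hab => Relation.TransGen.single hab

end IsStrictlySubinvariant

end NonnegativeMatrix

/-! ### Words acting on a processor -/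

/-- The number of letters `b` that the processor sends, over all feeds, when it reads the word `w`
starting from the state `q`. -/
def Processor.sent {I Q U : Type*} {B : U → Type*} [∀ u, DecidableEq (B u)]
    (p : Processor I Q B) (w : List I) (q : Q) (b : Σ u, B u) : ℕ :=
  (p.output b.1 w q).count b.2

namespace AbelianProcessor

variable {I Q U : Type*} {B : U → Type*} (p : AbelianProcessor I Q B)

theorem run_perm {w w' : List I} (h : w.Perm w') (q : Q) : p.run w q = p.run w' q := by
  induction h generalizing q with
  | nil => rfl
  | cons a _ ih => exact ih _
  | swap a b w => simp only [Processor.run, p.t_comm a b]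
  | trans _ _ ih ih' => rw [ih, ih']

theorem run_mem_transitionMonoid (w : List I) :
    (p.run w : Function.End Q) ∈ p.transitionMonoid := by
  induction w with
  | nil => exact p.transitionMonoid.one_mem
  | cons a w ih => exact p.transitionMonoid.mul_mem ih (Submonoid.subset_closure ⟨a, rfl⟩)

theorem exists_run_of_mem_transitionMonoid {m : Function.End Q} (hm : m ∈ p.transitionMonoid) :
    ∃ w, m = p.run w := by
  induction hm using Submonoid.closure_induction with
  | mem f hf => obtain ⟨a, rfl⟩ := hf; exact ⟨[a], rfl⟩
  | one => exact ⟨[], rfl⟩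
  | mul f g _ _ hf hg =>
    obtain ⟨w, rfl⟩ := hf
    obtain ⟨w', rfl⟩ := hg
    exact ⟨w' ++ w, funext fun q => (p.run_append w' w q).symm⟩

section Recurrence

variable {p} {q : Q}

theorem exists_run_append_eq_self (hq : q ∈ recurrentSet p.transitionMonoid) (w : List I) :
    ∃ z, p.run (w ++ z) q = q := by
  obtain ⟨e, he, y, rfl⟩ := hq
  obtain ⟨m, hm, hme⟩ := he.2.2 _ (p.run_mem_transitionMonoid w)
  obtain ⟨z, rfl⟩ := p.exists_run_of_mem_transitionMonoid hm
  refine ⟨z, (p.run_append w z _).trans ?_⟩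
  exact (congrFun hme (e y)).trans (congrFun he.2.1 y)

theorem mem_recurrentSet_of_forall_exists [Finite Q] (h : ∀ w, ∃ z, p.run (w ++ z) q = q) :
    q ∈ recurrentSet p.transitionMonoid := by
  obtain ⟨e, he⟩ := p.exists_minimalIdempotent
  obtain ⟨w, rfl⟩ := p.exists_run_of_mem_transitionMonoid he.1
  obtain ⟨z, hz⟩ := h w
  exact ⟨_, he, p.run z q, (p.run_append z w q).symm.trans
    ((p.run_perm List.perm_append_comm q).trans hz)⟩

theorem mem_recurrentSet_of_run_eq_self [Finite Q] {w : List I} (hw : ∀ a, a ∈ w)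
    (h : p.run w q = q) : q ∈ recurrentSet p.transitionMonoid := by
  refine mem_recurrentSet_of_forall_exists fun w' => ?_
  induction w' with
  | nil => exact ⟨[], rfl⟩
  | cons a w' ih =>
    obtain ⟨l, l', rfl⟩ := List.append_of_mem (hw a)
    obtain ⟨z, hz⟩ := ih
    have hperm : (a :: w' ++ ((l ++ l') ++ z)).Perm ((l ++ a :: l') ++ (w' ++ z)) := by
      refine (List.Perm.cons a ?_).trans (List.perm_middle.symm.append_right _)
      simpa using (List.perm_append_comm (l₁ := w') (l₂ := l ++ l')).append_right z
    exact ⟨(l ++ l') ++ z, by rw [p.run_perm hperm, run_append, h, hz]⟩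

theorem run_eq_self_of_mem_kernel [DecidableEq I] {z : List I}
    (hz : (fun a => (z.count a : ℤ)) ∈ p.kernel) (hq : q ∈ recurrentSet p.transitionMonoid) :
    p.run z q = q := by
  obtain ⟨w, w', hcount, hrun⟩ := hz
  have hperm : w.Perm (w' ++ z) := List.perm_iff_count.2 fun a => by
    rw [List.count_append]
    have : (z.count a : ℤ) = w.count a - w'.count a := hcount a
    omega
  obtain ⟨y, hy⟩ := exists_run_append_eq_self hq w'
  have hz : p.run (w' ++ z) q = p.run w' q := by rw [← p.run_perm hperm, hrun q hq]
  calc p.run z q = p.run (z ++ (w' ++ y)) q := by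
        rw [p.run_perm List.perm_append_comm, run_append, hy]
    _ = p.run ((w' ++ z) ++ y) q := p.run_perm
        (by simpa using (List.perm_append_comm (l₁ := z) (l₂ := w')).append_right y) q
    _ = q := by rw [run_append, hz, ← run_append, hy]

end Recurrence

section Sent

variable [∀ u, DecidableEq (B u)]

theorem sent_nil (q : Q) : p.sent [] q = 0 := rfl

theorem sent_append (w w' : List I) (q : Q) :
    p.sent (w ++ w') q = p.sent w q + p.sent w' (p.run w q) := by
  funext b
  induction w generalizing q with
  | nil => simp [Processor.sent, Processor.output, Processor.run]
  | cons a w ih =>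
    simp only [Processor.sent, Pi.add_apply] at ih
    simp [Processor.sent, Processor.output, Processor.run, ih, add_assoc]

theorem sent_cons (a : I) (w : List I) (q : Q) :
    p.sent (a :: w) q = p.sent [a] q + p.sent w (p.t a q) := p.sent_append [a] w q

theorem sent_perm {w w' : List I} (h : w.Perm w') (q : Q) : p.sent w q = p.sent w' q :=
  funext fun b => (p.output_perm w w' h q b.1).count_eq b.2

theorem sent_mono {w w' : List I} (h : w.Subperm w') (q : Q) : p.sent w q ≤ p.sent w' q := by
  classical
  rw [← p.sent_perm (List.subperm_append_diff_self_of_count_le fun a _ => h.count_le a),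
    sent_append]
  exact le_self_add

theorem sent_run_of_run_eq_self {z : List I} {q : Q} (hz : p.run z q = q) (w : List I) :
    p.sent z (p.run w q) = p.sent z q := by
  have := p.sent_perm (List.perm_append_comm (l₁ := w) (l₂ := z)) q
  rwa [sent_append, sent_append, hz, add_comm, add_left_inj] at this

theorem sent_eq_of_isIrreducibleAction (hp : IsIrreducibleAction p.transitionMonoid)
    {z : List I} {q q' : Q} (hq : p.run z q = q) (hq' : p.run z q' = q') :
    p.sent z q = p.sent z q' := by
  obtain ⟨m, hm, m', hm', heq⟩ := hp.2 q q'
  obtain ⟨w, rfl⟩ := p.exists_run_of_mem_transitionMonoid hm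
  obtain ⟨w', rfl⟩ := p.exists_run_of_mem_transitionMonoid hm'
  rw [← p.sent_run_of_run_eq_self hq w, heq, p.sent_run_of_run_eq_self hq']

theorem exists_sent_singleton_pos {a : I} {m : ℕ} {q : Q} {b : Σ u, B u}
    (h : 0 < p.sent (List.replicate m a) q b) :
    ∃ j, 0 < p.sent [a] (p.run (List.replicate j a) q) b := by
  induction m generalizing q with
  | zero => simp [sent_nil] at h
  | succ m ih =>
    rw [List.replicate_succ, sent_cons, Pi.add_apply] at h
    rcases Nat.add_pos_iff_pos_or_pos.1 h with h | h
    · exact ⟨0, h⟩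
    · obtain ⟨j, hj⟩ := ih h
      exact ⟨j + 1, hj⟩

end Sent

/-! ### Periodic processors -/

/-- On the invariant set `S` of states, reading `r a` letters `a` returns the processor to its
state and sends column `a` of `R`. Both a network on its locally recurrent states and its
sandpilization on all states are of this form, with `R = P D` up to renaming of letters. -/
structure IsPeriodicOn [∀ u, DecidableEq (B u)] (S : Set Q) (r : I → ℕ)
    (R : Matrix (Σ u, B u) I ℕ) : Prop where
  pos : ∀ a, 0 < r a
  t_mem : ∀ a, ∀ q ∈ S, p.t a q ∈ S
  run_replicate : ∀ a, ∀ q ∈ S, p.run (List.replicate (r a) a) q = q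
  sent_replicate : ∀ a, ∀ q ∈ S, p.sent (List.replicate (r a) a) q = R.col a

namespace IsPeriodicOn

variable [∀ u, DecidableEq (B u)] {p} {S : Set Q} {r : I → ℕ} {R : Matrix (Σ u, B u) I ℕ} {q : Q}

theorem mapsTo_run (h : p.IsPeriodicOn S r R) (w : List I) : Set.MapsTo (p.run w) S S := by
  induction w with
  | nil => exact Set.mapsTo_id S
  | cons a w ih => exact ih.comp (h.t_mem a)

theorem injOn_t (h : p.IsPeriodicOn S r R) (a : I) : Set.InjOn (p.t a) S := by
  obtain ⟨m, hm⟩ := Nat.exists_eq_add_one.2 (h.pos a)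
  have hleft : Set.LeftInvOn (p.run (List.replicate m a)) (p.t a) S := fun q hq => by
    have := h.run_replicate a q hq
    rwa [hm] at this
  exact hleft.injOn

theorem injOn_run (h : p.IsPeriodicOn S r R) (w : List I) : Set.InjOn (p.run w) S := by
  induction w with
  | nil => exact Set.injOn_id S
  | cons a w ih => exact ih.comp (h.injOn_t a) (h.t_mem a)

theorem sent_eq_zero (h : p.IsPeriodicOn S r R) (hq : q ∈ S) {b : Σ u, B u}
    {w : List I} (hw : ∀ a ∈ w, R b a = 0) : p.sent w q b = 0 := by
  induction w generalizing q with
  | nil => rfl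
  | cons a w ih =>
    have hsub : [a].Subperm (List.replicate (r a) a) :=
      (List.replicate_sublist_replicate a (m := 1).2 (h.pos a)).subperm
    have hle := p.sent_mono hsub q b
    rw [h.sent_replicate a q hq, Matrix.col_apply, hw a List.mem_cons_self] at hle
    rw [sent_cons, Pi.add_apply, Nat.le_zero.1 hle, zero_add]
    exact ih (h.t_mem a q hq) fun c hc => hw c (List.mem_cons_of_mem a hc)

theorem sent_run_eq (h : p.IsPeriodicOn S r R) (hq : q ∈ S) {b : Σ u, B u}
    {z : List I} (hz : ∀ a ∈ z, R b a = 0) (w : List I) :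
    p.sent w (p.run z q) b = p.sent w q b := by
  have := congrFun (p.sent_perm (List.perm_append_comm (l₁ := z) (l₂ := w)) q) b
  rwa [sent_append, sent_append, Pi.add_apply, Pi.add_apply, h.sent_eq_zero hq hz,
    h.sent_eq_zero (h.mapsTo_run w hq) hz, zero_add, add_zero] at this

theorem exists_list_run_eq_self [Fintype I] [DecidableEq I] (h : p.IsPeriodicOn S r R)
    (k : I → ℕ) : ∃ w : List I, (∀ a, w.count a = r a * k a) ∧
      ∀ q ∈ S, p.run w q = q ∧ p.sent w q = R.mulVec k := by
  obtain ⟨l, hl⟩ := exists_list_count_eq k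
  obtain rfl : (fun a => l.count a) = k := funext hl
  clear hl
  induction l with
  | nil => exact ⟨[], by simp, fun q _ => ⟨rfl, by simp [sent_nil, ← Pi.zero_def]⟩⟩
  | cons a l ih =>
    obtain ⟨w, hw, hS⟩ := ih
    refine ⟨List.replicate (r a) a ++ w, fun c => ?_, fun q hq => ?_⟩
    · rw [List.count_append, hw]
      rcases eq_or_ne a c with rfl | hac
      · simp [mul_add, add_comm]
      · simp [List.count_replicate, hac]
    · rw [run_append, sent_append, h.run_replicate a q hq, h.sent_replicate a q hq, (hS q hq).2,
        count_cons_eq_single_add, Matrix.mulVec_add, Matrix.mulVec_single_one]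
      exact ⟨(hS q hq).1, rfl⟩

theorem exists_forall_sent_pos (h : p.IsPeriodicOn S r R) (hS : S.Nonempty)
    {ι : Type*} [Finite ι] {α : ι → I} {β : ι → Σ u, B u}
    (hR : ∀ i j, 0 < R (β j) (α i) ↔ i = j) : ∃ q ∈ S, ∀ j, 0 < p.sent [α j] q (β j) := by
  classical
  have := Fintype.ofFinite ι
  suffices ∀ s : Finset ι, ∃ q ∈ S, ∀ j ∈ s, 0 < p.sent [α j] q (β j) by
    simpa using this Finset.univ
  intro s
  induction s using Finset.induction_on with
  | empty => exact ⟨hS.some, hS.some_mem, by simp⟩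
  | insert i s hi ih =>
    obtain ⟨q, hq, hs⟩ := ih
    obtain ⟨m, hm⟩ : ∃ m, 0 < p.sent [α i] (p.run (List.replicate m (α i)) q) (β i) := by
      refine p.exists_sent_singleton_pos (m := r (α i)) ?_
      rw [h.sent_replicate _ q hq]
      exact (hR i i).2 rfl
    refine ⟨_, h.mapsTo_run (List.replicate m (α i)) hq, fun j hj => ?_⟩
    rcases Finset.mem_insert.1 hj with rfl | hjs
    · exact hm
    · rw [h.sent_run_eq hq]
      · exact hs j hjs
      · intro a ha
        obtain rfl := List.eq_of_mem_replicate ha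
        exact Nat.eq_zero_of_not_pos fun hpos => hi ((hR i j).1 hpos ▸ hjs)

end IsPeriodicOn

end AbelianProcessor

/-! ### Executions and halting -/

namespace AbelianNetwork

variable {V : Type*} {A Q : V → Type*} [DecidableEq V] (N : AbelianNetwork V A Q)

/-- The network as a single processor, which reads a letter by handing it to the vertex it belongs
to, and whose feeds are the vertices. -/
def localProcessor : AbelianProcessor (Σ v, A v) (∀ v, Q v) A where
  t a q := Function.update q a.1 ((N.proc a.1).t a.2 (q a.1))
  o a u q := (N.proc a.1).o a.2 u (q a.1)
  t_comm := by
    rintro ⟨v, a⟩ ⟨u, b⟩ q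
    rcases eq_or_ne v u with rfl | h
    · simp [(N.proc v).t_comm a b]
    · simp only [Function.update_of_ne h, Function.update_of_ne h.symm]
      exact Function.update_comm h.symm _ _ _
  output_perm w w' h q u := by
    induction h generalizing q with
    | nil => rfl
    | cons a _ ih => exact (ih _).append_left _
    | swap a b w =>
      obtain ⟨v, a⟩ := a
      obtain ⟨v', b⟩ := b
      simp only [Processor.output, ← List.append_assoc]
      rcases eq_or_ne v v' with rfl | h
      · have := (N.proc v).output_perm [b, a] [a, b] (.swap a b []) (q v) u
        simpa [Processor.output, (N.proc v).t_comm a b] using this.append_right _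
      · simp only [Function.update_of_ne h, Function.update_of_ne h.symm,
          Function.update_comm h.symm]
        exact List.perm_append_comm.append_right _
    | trans _ _ ih ih' => exact (ih q).trans (ih' q)

variable {N} [∀ v, DecidableEq (A v)]

theorem exec_eq (w : List (Σ v, A v)) (s : ((Σ v, A v) → ℤ) × (∀ v, Q v)) :
    N.exec w s = (fun b => s.1 b - w.count b + N.localProcessor.sent w s.2 b,
      N.localProcessor.run w s.2) := by
  induction w generalizing s with
  | nil => simp [exec, AbelianProcessor.sent_nil, Processor.run]
  | cons a w ih =>
    rw [exec, ih]
    refine Prod.ext (funext fun b => ?_) rfl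
    simp only [step, Processor.sent, Processor.output, localProcessor, List.count_cons, beq_iff_eq,
      eq_comm (a := a), List.count_append]
    push_cast
    ring

theorem exec_append (w w' : List (Σ v, A v)) (s : ((Σ v, A v) → ℤ) × (∀ v, Q v)) :
    N.exec (w ++ w') s = N.exec w' (N.exec w s) := by
  induction w generalizing s with
  | nil => rfl
  | cons a _ ih => exact ih _

theorem isLegal_append {w w' : List (Σ v, A v)} {s : ((Σ v, A v) → ℤ) × (∀ v, Q v)} :
    N.IsLegal (w ++ w') s ↔ N.IsLegal w s ∧ N.IsLegal w' (N.exec w s) := by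
  induction w generalizing s with
  | nil => simp [IsLegal, exec]
  | cons a w ih => simp only [List.cons_append, IsLegal, ih, exec, and_assoc]

theorem IsLegal.mono {w : List (Σ v, A v)} {x y : (Σ v, A v) → ℤ} {q : ∀ v, Q v} (hxy : x ≤ y)
    (h : N.IsLegal w (x, q)) : N.IsLegal w (y, q) := by
  induction w generalizing x y q with
  | nil => trivial
  | cons a w ih =>
    refine ⟨h.1.trans (hxy a), ih (fun b => ?_) h.2⟩
    gcongr
    exact hxy b

theorem IsLegal.exec_nonneg {w : List (Σ v, A v)} {s : ((Σ v, A v) → ℤ) × (∀ v, Q v)}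
    (h : N.IsLegal w s) (hs : 0 ≤ s.1) : 0 ≤ (N.exec w s).1 := by
  induction w generalizing s with
  | nil => exact hs
  | cons a w ih =>
    refine ih h.2 fun b => add_nonneg ?_ (Int.natCast_nonneg _)
    rcases eq_or_ne b a with rfl | hb
    · simpa using h.1
    · simpa [hb] using hs b

/-- The least action principle: a legal word processes no letter more often than a complete word
does. It is enough that `c` is complete for those letters on which this is in doubt. -/
theorem IsLegal.count_le {w c : List (Σ v, A v)} {s : ((Σ v, A v) → ℤ) × (∀ v, Q v)}
    (hw : N.IsLegal w s) (hc : ∀ b, (N.exec c s).1 b ≤ 0 ∨ w.count b ≤ c.count b)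
    (b : Σ v, A v) : w.count b ≤ c.count b := by
  induction w using List.reverseRecOn generalizing b with
  | nil => simp
  | append_singleton w a ih =>
    obtain ⟨hlegal, hpresent, -⟩ := isLegal_append.1 hw
    have hle := ih hlegal fun b => (hc b).imp_right fun h => le_trans (by simp) h
    rcases eq_or_ne a b with rfl | hb
    · rcases hc a with hcomplete | h
      · have hsent : N.localProcessor.sent w s.2 a ≤ N.localProcessor.sent c s.2 a :=
          N.localProcessor.sent_mono (List.subperm_ext_iff.2 fun b _ => hle b) s.2 a
        rw [exec_eq] at hcomplete hpresent
        dsimp only at hcomplete hpresent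
        rw [List.count_append, List.count_singleton_self]
        omega
      · exact h
    · simpa [List.count_append, List.count_singleton, hb] using hle b

theorem haltsOn_of_isComplete {x : (Σ v, A v) → ℕ} {q : ∀ v, Q v} {c : List (Σ v, A v)}
    (hc : N.IsComplete c (fun a => (x a : ℤ), q)) : N.HaltsOn x q := by
  by_contra! hhalt
  have hlong (n : ℕ) : ∃ w : List (Σ v, A v), w.length = n ∧
      N.IsLegal w (fun a => (x a : ℤ), q) := by
    induction n with
    | zero => exact ⟨[], rfl, trivial⟩
    | succ n ih =>
      obtain ⟨w, hn, hw⟩ := ih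
      obtain ⟨a, ha⟩ : ∃ a, 0 < (N.exec w (fun a => (x a : ℤ), q)).1 a := by
        by_contra! hw'
        exact hhalt ⟨w, hw, hw'⟩
      exact ⟨w ++ [a], by simp [hn], isLegal_append.2 ⟨hw, ha, trivial⟩⟩
  obtain ⟨w, hn, hw⟩ := hlong (c.length + 1)
  have hsub : w.Subperm c := List.subperm_ext_iff.2 fun b _ => hw.count_le (fun b => .inl (hc b)) b
  exact absurd hsub.length_le (by omega)

/-- `w` is a complete legal execution for the configuration `x.q`. -/
def IsCompleteLegal (N : AbelianNetwork V A Q) (x : (Σ v, A v) → ℕ) (q : ∀ v, Q v)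
    (w : List (Σ v, A v)) : Prop :=
  N.IsLegal w (fun a => (x a : ℤ), q) ∧ N.IsComplete w (fun a => (x a : ℤ), q)

namespace IsCompleteLegal

variable {x y : (Σ v, A v) → ℕ} {q : ∀ v, Q v} {w w' : List (Σ v, A v)}

theorem exec_fst_eq_zero (h : N.IsCompleteLegal x q w) :
    (N.exec w (fun a => (x a : ℤ), q)).1 = 0 :=
  le_antisymm h.2 (h.1.exec_nonneg fun a => Int.natCast_nonneg (x a))

theorem add_sent_eq_count (h : N.IsCompleteLegal x q w) (b : Σ v, A v) :
    x b + N.localProcessor.sent w q b = w.count b := by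
  have hzero := congrFun h.exec_fst_eq_zero b
  simp only [exec_eq, Pi.zero_apply] at hzero
  omega

theorem perm (h : N.IsCompleteLegal x q w) (h' : N.IsCompleteLegal x q w') : w.Perm w' :=
  List.perm_iff_count.2 fun b => le_antisymm (h.1.count_le (fun b => .inl (h'.2 b)) b)
    (h'.1.count_le (fun b => .inl (h.2 b)) b)

theorem append (h : N.IsCompleteLegal x q w)
    (h' : N.IsCompleteLegal y (N.localProcessor.run w q) w') :
    N.IsCompleteLegal (x + y) q (w ++ w') := by
  have hexec : N.exec w (fun a => ((x + y) a : ℤ), q) =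
      (fun a => (y a : ℤ), N.localProcessor.run w q) := by
    rw [exec_eq]
    refine Prod.ext (funext fun b => ?_) rfl
    have := h.add_sent_eq_count b
    simp only [Pi.add_apply]
    push_cast
    omega
  refine ⟨isLegal_append.2 ⟨h.1.mono fun a => by simp, ?_⟩, ?_⟩
  · rw [hexec]
    exact h'.1
  · rw [IsComplete, exec_append, hexec]
    exact h'.2

theorem globalAct_eq (h : N.IsCompleteLegal x q w) :
    N.globalAct x q = N.localProcessor.run w q := by
  have hhalt : N.HaltsOn x q := ⟨w, h⟩
  rw [globalAct, dif_pos hhalt, exec_eq]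
  exact N.localProcessor.run_perm (IsCompleteLegal.perm hhalt.choose_spec h) q

end IsCompleteLegal

/-! ### The global action -/

theorem globalAct_zero (q : ∀ v, Q v) : N.globalAct 0 q = q :=
  IsCompleteLegal.globalAct_eq (w := []) ⟨trivial, fun a => by simp [exec]⟩

theorem HaltsOnAllInputs.globalAct_add (hN : N.HaltsOnAllInputs) (x y : (Σ v, A v) → ℕ)
    (q : ∀ v, Q v) : N.globalAct (x + y) q = N.globalAct y (N.globalAct x q) := by
  obtain ⟨w, hw⟩ := hN x q
  obtain ⟨w', hw'⟩ := hN y (N.localProcessor.run w q)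
  rw [(IsCompleteLegal.append hw hw').globalAct_eq, IsCompleteLegal.globalAct_eq hw,
    IsCompleteLegal.globalAct_eq hw', AbelianProcessor.run_append]

/-- The global action of a network that halts on all inputs, as a processor without output; its
transition monoid is the global monoid of the network. -/
noncomputable def globalProcessor (hN : N.HaltsOnAllInputs) :
    AbelianProcessor (Σ v, A v) (∀ v, Q v) (fun _ : Empty => Empty) where
  t a q := N.globalAct (Pi.single a 1) q
  o _ u _ := u.elim
  t_comm a b q := by rw [← hN.globalAct_add, ← hN.globalAct_add, add_comm]
  output_perm _ _ _ _ u := u.elim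

theorem globalProcessor_run (hN : N.HaltsOnAllInputs) (w : List (Σ v, A v)) (q : ∀ v, Q v) :
    (globalProcessor hN).run w q = N.globalAct (fun b => w.count b) q := by
  induction w generalizing q with
  | nil => exact (globalAct_zero q).symm
  | cons a w ih =>
    rw [count_cons_eq_single_add, hN.globalAct_add]
    exact ih _

theorem isRecurrent_iff (hN : N.HaltsOnAllInputs) {q : ∀ v, Q v} :
    N.IsRecurrent q ↔ q ∈ recurrentSet (globalProcessor hN).transitionMonoid := Iff.rfl

end AbelianNetwork

/-! ### Recurrence in periodic networks -/

namespace AbelianProcessor.IsPeriodicOn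

variable {V : Type*} {A Q : V → Type*} [DecidableEq V] [∀ v, DecidableEq (A v)]
  {N : AbelianNetwork V A Q} {S : Set (∀ v, Q v)} {r : (Σ v, A v) → ℕ}
  {R : Matrix (Σ v, A v) (Σ v, A v) ℕ} {q : ∀ v, Q v}

section Halting

variable [Fintype V] [∀ v, Fintype (A v)]

theorem exists_mulVec_lt (h : N.localProcessor.IsPeriodicOn S r R) (hS : S.Nonempty)
    (hN : N.HaltsOnAllInputs) : ∃ k : (Σ v, A v) → ℕ, ∀ b, R.mulVec k b < r b * k b := by
  obtain ⟨q, hq⟩ := hS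
  obtain ⟨w, hw⟩ := hN r q
  obtain ⟨z, hz, hzS⟩ := h.exists_list_run_eq_self fun a => w.count a / r a
  have hzw : z.Subperm w := List.subperm_ext_iff.2 fun a _ => (hz a).trans_le (Nat.mul_div_le _ _)
  refine ⟨fun a => w.count a / r a, fun b => ?_⟩
  change R.mulVec (fun a => w.count a / r a) b < r b * (w.count b / r b)
  have hle : R.mulVec (fun a => w.count a / r a) b ≤ N.localProcessor.sent w q b :=
    (hzS q hq).2 ▸ N.localProcessor.sent_mono hzw q b
  have hcount := AbelianNetwork.IsCompleteLegal.add_sent_eq_count hw b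
  have hdiv := Nat.div_add_mod (w.count b) (r b)
  have hmod := Nat.mod_lt (w.count b) (h.pos b)
  omega

theorem haltsOnAllInputs (h : N.localProcessor.IsPeriodicOn Set.univ r R) {k : (Σ v, A v) → ℕ}
    (hk : ∀ b, R.mulVec k b < r b * k b) : N.HaltsOnAllInputs := by
  intro x q
  obtain ⟨w, hw, hwS⟩ := h.exists_list_run_eq_self ((∑ c, x c) • k)
  refine AbelianNetwork.haltsOn_of_isComplete (c := w) fun b => ?_
  have hx : x b ≤ ∑ c, x c :=
    Finset.single_le_sum (fun _ _ => Nat.zero_le _) (Finset.mem_univ b)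
  have hle : (∑ c, x c) + (∑ c, x c) * R.mulVec k b ≤ (∑ c, x c) * (r b * k b) := by
    rw [add_comm, ← mul_add_one]
    exact Nat.mul_le_mul_left _ (hk b)
  simp only [AbelianNetwork.exec_eq, (hwS q trivial).2, hw, Matrix.mulVec_smul, Pi.smul_apply,
    smul_eq_mul, Nat.mul_left_comm (r b), Pi.zero_apply]
  omega

end Halting

/-- If a word `w` uses up the input `x` exactly, then what a complete legal execution leaves
unprocessed of `w` would contain a letter that receives nothing from the rest. -/
theorem perm_of_wellFounded (h : N.localProcessor.IsPeriodicOn S r R)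
    (hwf : WellFounded fun a b => 0 < R b a) (hq : q ∈ S) {x : (Σ v, A v) → ℕ}
    {c w : List (Σ v, A v)} (hc : N.IsCompleteLegal x q c)
    (hw : ∀ b, x b + N.localProcessor.sent w q b = w.count b) : c.Perm w := by
  have hcw : ∀ b, c.count b ≤ w.count b := hc.1.count_le fun b => .inl <| by
    have := hw b
    simp only [AbelianNetwork.exec_eq]
    omega
  have hperm := List.subperm_append_diff_self_of_count_le fun b _ => hcw b
  set d := w.diff c
  have hd (b : Σ v, A v) : d.count b = N.localProcessor.sent d (N.localProcessor.run c q) b := by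
    have hsum := hw b
    have hcsum := hc.add_sent_eq_count b
    rw [← N.localProcessor.sent_perm hperm, ← hperm.count_eq, sent_append, List.count_append,
      Pi.add_apply] at hsum
    omega
  suffices hnil : d = [] by rwa [hnil, List.append_nil] at hperm
  by_contra hne
  obtain ⟨b, hb, hmin⟩ := hwf.has_min {b | b ∈ d} (List.exists_mem_of_ne_nil d hne)
  have hzero : N.localProcessor.sent d (N.localProcessor.run c q) b = 0 :=
    h.sent_eq_zero (h.mapsTo_run c hq) fun a ha => Nat.eq_zero_of_not_pos (hmin a ha)
  exact (List.count_pos_iff.2 hb).ne' ((hd b).trans hzero)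

theorem isRecurrent [Finite V] [∀ v, Finite (A v)] [∀ v, Finite (Q v)]
    (h : N.localProcessor.IsPeriodicOn S r R) (hN : N.HaltsOnAllInputs)
    (hwf : WellFounded fun a b => 0 < R b a) (hq : q ∈ S) : N.IsRecurrent q := by
  have := Fintype.ofFinite V
  have (v : V) := Fintype.ofFinite (A v)
  obtain ⟨k, hk⟩ := h.exists_mulVec_lt ⟨q, hq⟩ hN
  obtain ⟨w, hw, hwS⟩ := h.exists_list_run_eq_self k
  obtain ⟨l, hl⟩ := exists_list_count_eq fun b => r b * k b - R.mulVec k b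
  obtain ⟨c, hc⟩ := hN (fun b => l.count b) q
  have hcw : c.Perm w := h.perm_of_wellFounded hwf hq hc fun b => by
    rw [hl, hw, (hwS q hq).2]
    exact Nat.sub_add_cancel (hk b).le
  have hrun : (AbelianNetwork.globalProcessor hN).run l q = q := by
    rw [AbelianNetwork.globalProcessor_run, AbelianNetwork.IsCompleteLegal.globalAct_eq hc,
      N.localProcessor.run_perm hcw, (hwS q hq).1]
  refine (AbelianNetwork.isRecurrent_iff hN).2
    (mem_recurrentSet_of_run_eq_self (fun b => List.count_pos_iff.1 ?_) hrun)
  rw [hl]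
  exact Nat.sub_pos_of_lt (hk b)

/-- A legal execution returning to the final state of `w` could be shortened by `w`, against the
least action principle. -/
theorem not_isRecurrent_run (h : N.localProcessor.IsPeriodicOn S r R) (hN : N.HaltsOnAllInputs)
    (hq : q ∈ S) {w : List (Σ v, A v)} (hne : w ≠ [])
    (hw : ∀ b ∈ w, w.count b ≤ N.localProcessor.sent w q b) :
    ¬ N.IsRecurrent (N.localProcessor.run w q) := by
  intro hrec
  set q' := N.localProcessor.run w q
  obtain ⟨z, hz⟩ := exists_run_append_eq_self ((AbelianNetwork.isRecurrent_iff hN).1 hrec) w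
  obtain ⟨u, hu⟩ : ∃ u, N.IsCompleteLegal (fun b => (w ++ z).count b) q' u := hN _ q'
  rw [AbelianNetwork.globalProcessor_run, hu.globalAct_eq] at hz
  have hwu : ∀ b ∈ w, w.count b ≤ u.count b := fun b _ => by
    rw [← hu.add_sent_eq_count b, List.count_append, add_assoc]
    exact le_self_add
  set c := u.diff w
  have hperm : u.Perm (c ++ w) :=
    (List.subperm_append_diff_self_of_count_le hwu).symm.trans List.perm_append_comm
  have hreturn : N.localProcessor.run c q' = q := by
    refine h.injOn_run w (h.mapsTo_run c (h.mapsTo_run w hq)) hq ?_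
    rw [← run_append, ← N.localProcessor.run_perm hperm, hz]
  have huc : ∀ b, u.count b ≤ c.count b := hu.1.count_le fun b => by
    have hcount := hperm.count_eq b
    rw [List.count_append] at hcount
    by_cases hb : b ∈ w
    · left
      have hsum := hu.add_sent_eq_count b
      rw [N.localProcessor.sent_perm hperm, sent_append, hreturn, Pi.add_apply] at hsum
      have := hw b hb
      simp only [AbelianNetwork.exec_eq]
      omega
    · right
      rw [hcount, List.count_eq_zero_of_not_mem hb, add_zero]
  have hlen := (List.subperm_ext_iff.2 fun b _ => huc b).length_le
  rw [hperm.length_eq, List.length_append] at hlen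
  exact hne (List.length_eq_zero_iff.1 (by omega))

theorem not_isRecurrent_run_toList (h : N.localProcessor.IsPeriodicOn S r R)
    (hN : N.HaltsOnAllInputs) (hq : q ∈ S) {C : Finset (Σ v, A v)} (hC : C.Nonempty)
    (hsent : ∀ b ∈ C, ∃ a ∈ C, 0 < N.localProcessor.sent [a] q b) :
    ¬ N.IsRecurrent (N.localProcessor.run C.toList q) := by
  refine h.not_isRecurrent_run hN hq (by simpa using hC.ne_empty) fun b hb => ?_
  obtain ⟨a, ha, hab⟩ := hsent b (Finset.mem_toList.1 hb)
  have hsub : [a].Subperm C.toList := (List.singleton_sublist.2 (Finset.mem_toList.2 ha)).subperm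
  exact (List.nodup_iff_count_le_one.1 C.nodup_toList b).trans
    (hab.trans_le (N.localProcessor.sent_mono hsub q b))

theorem wellFounded_of_isRecurrent [Finite V] [∀ v, Finite (A v)]
    (h : N.localProcessor.IsPeriodicOn S r R) (hS : S.Nonempty) (hN : N.HaltsOnAllInputs)
    (hrec : ∀ q ∈ S, N.IsRecurrent q) : WellFounded fun a b => 0 < R b a := by
  by_contra hwf
  obtain ⟨C, p, ⟨c, hc⟩, hp⟩ := exists_equiv_rel_iff_of_not_wellFounded hwf
  obtain ⟨q, hq, hsent⟩ := h.exists_forall_sent_pos hS (α := fun b : C => (p b : Σ v, A v))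
    (β := Subtype.val) fun i j => by rw [hp, p.apply_eq_iff_eq]
  refine h.not_isRecurrent_run_toList hN hq (C := C.toFinite.toFinset) ⟨c, by simpa using hc⟩
    (fun b hb => ⟨p ⟨b, by simpa using hb⟩, by simp, hsent ⟨b, by simpa using hb⟩⟩) ?_
  exact hrec _ (h.mapsTo_run _ hq)

end AbelianProcessor.IsPeriodicOn

/-! ### Locally recurrent states -/

namespace AbelianNetwork

section LocalProcessor

variable {V : Type*} {A Q : V → Type*} [DecidableEq V] {N : AbelianNetwork V A Q}

theorem localProcessor_run_map {v : V} (w : List (A v)) (q : ∀ v, Q v) :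
    N.localProcessor.run (w.map (Sigma.mk v)) q =
      Function.update q v ((N.proc v).run w (q v)) := by
  induction w generalizing q with
  | nil => simp [Processor.run]
  | cons a w ih =>
    refine (ih (Function.update q v ((N.proc v).t a (q v)))).trans ?_
    rw [Function.update_self, Function.update_idem, Processor.run]

theorem localProcessor_sent_map [∀ v, DecidableEq (A v)] {v : V} (w : List (A v)) (q : ∀ v, Q v) :
    N.localProcessor.sent (w.map (Sigma.mk v)) q = (N.proc v).sent w (q v) := by
  induction w generalizing q with
  | nil => rfl
  | cons a w ih =>
    have htail := ih (Function.update q v ((N.proc v).t a (q v)))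
    rw [Function.update_self] at htail
    rw [List.map_cons, N.localProcessor.sent_cons, (N.proc v).sent_cons]
    exact congrArg (N.localProcessor.sent [⟨v, a⟩] q + ·) htail

theorem isPeriodicOn_localProcessor [∀ v, DecidableEq (A v)] {S : ∀ v, Set (Q v)}
    {r : (Σ v, A v) → ℕ} {R : Matrix (Σ v, A v) (Σ v, A v) ℕ}
    (h : ∀ v, (N.proc v).IsPeriodicOn (S v) (fun a => r ⟨v, a⟩) (R.submatrix id (Sigma.mk v))) :
    N.localProcessor.IsPeriodicOn {q | ∀ v, q v ∈ S v} r R where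
  pos a := (h a.1).pos a.2
  t_mem a q hq v := by
    change Function.update q a.1 _ v ∈ S v
    rcases eq_or_ne v a.1 with rfl | hv
    · rw [Function.update_self]
      exact (h a.1).t_mem a.2 _ (hq a.1)
    · rw [Function.update_of_ne hv]
      exact hq v
  run_replicate a q hq := by
    rw [← List.map_replicate (f := Sigma.mk a.1), localProcessor_run_map,
      (h a.1).run_replicate a.2 _ (hq a.1), Function.update_eq_self]
  sent_replicate a q hq := by
    rw [← List.map_replicate (f := Sigma.mk a.1), localProcessor_sent_map,
      (h a.1).sent_replicate a.2 _ (hq a.1)]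
    rfl

end LocalProcessor

variable {V : Type*} {A Q : V → Type*} [DecidableEq V] [∀ v, DecidableEq (A v)]
  (N : AbelianNetwork V A Q)

/-- The integer matrix `P D`, whose column `a` is `P_q(r_a 1_a)`. -/
noncomputable def productionCount (q : ∀ v, Q v) : Matrix (Σ v, A v) (Σ v, A v) ℕ :=
  Matrix.of fun b a => N.localProcessor.sent (List.replicate (N.resetNumber a) a) q b

theorem productionCount_apply {v : V} (q : ∀ v, Q v) (b : Σ v, A v) (a : A v) :
    N.productionCount q b ⟨v, a⟩ =
      (N.proc v).sent (List.replicate (N.resetNumber ⟨v, a⟩) a) (q v) b := by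
  rw [← localProcessor_sent_map, List.map_replicate]
  rfl

theorem productionMatrix_apply (q : ∀ v, Q v) (a b : Σ v, A v) :
    N.productionMatrix q b a = (N.productionCount q b a : ℚ) / N.resetNumber a := by
  simp [productionMatrix, productionCount, localAct, exec_eq]

variable [∀ v, Finite (Q v)]

theorem resetNumber_ne_zero (a : Σ v, A v) : N.resetNumber a ≠ 0 :=
  Nat.one_le_iff_ne_zero.1 (N.one_le_resetNumber a)

theorem count_replicate_resetNumber_mem_kernel {v : V} (a : A v) :
    (fun b => ((List.replicate (N.resetNumber ⟨v, a⟩) a).count b : ℤ)) ∈ (N.proc v).kernel := by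
  convert (Nat.sInf_mem (Nat.nonempty_of_pos_sInf (N.one_le_resetNumber ⟨v, a⟩))).2 v using 1
  funext b
  rcases eq_or_ne a b with rfl | hab
  · simp [resetNumber]
  · rw [Pi.single_eq_of_ne (by simpa using hab.symm)]
    simp [List.count_replicate, hab]

theorem isPeriodicOn_isLocallyRecurrent {N : AbelianNetwork V A Q} (hN : N.IsIrreducible)
    {q₀ : ∀ v, Q v} (hq₀ : N.IsLocallyRecurrent q₀) :
    N.localProcessor.IsPeriodicOn {q | N.IsLocallyRecurrent q} N.resetNumber
      (N.productionCount q₀) :=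
  isPeriodicOn_localProcessor fun v =>
    have hrun (a : A v) {q : Q v} (hq : q ∈ recurrentSet (N.proc v).transitionMonoid) :=
      AbelianProcessor.run_eq_self_of_mem_kernel (N.count_replicate_resetNumber_mem_kernel a) hq
    { pos a := N.one_le_resetNumber ⟨v, a⟩
      t_mem a _ hq := (N.proc v).run_mem_recurrentSet [a] hq
      run_replicate a _ hq := hrun a hq
      sent_replicate a _ hq := by
        rw [(N.proc v).sent_eq_of_isIrreducibleAction (hN v) (hrun a hq) (hrun a (hq₀ v))]
        exact funext fun b => (N.productionCount_apply q₀ b a).symm }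

/-! ### The production matrix -/

theorem productionMatrix_pos_iff (q : ∀ v, Q v) (a b : Σ v, A v) :
    0 < N.productionMatrix q b a ↔ 0 < N.productionCount q b a := by
  have hr : (0 : ℚ) < N.resetNumber a := Nat.cast_pos.2 (N.one_le_resetNumber a)
  rw [productionMatrix_apply, div_pos_iff_of_pos_right hr, Nat.cast_pos]

variable [Fintype V] [∀ v, Fintype (A v)]

theorem productionMatrix_mulVec (q : ∀ v, Q v) (k : (Σ v, A v) → ℕ) (b : Σ v, A v) :
    (N.productionMatrix q).mulVec (fun a => (N.resetNumber a * k a : ℚ)) b =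
      (N.productionCount q).mulVec k b := by
  have hr (a : Σ v, A v) : (N.resetNumber a : ℚ) ≠ 0 := Nat.cast_ne_zero.2 (N.resetNumber_ne_zero a)
  simp only [Matrix.mulVec, dotProduct, productionMatrix_apply, ← mul_assoc,
    div_mul_cancel₀ _ (hr _)]
  push_cast
  rfl

theorem isStrictlySubinvariant_productionMatrix {N : AbelianNetwork V A Q} {q : ∀ v, Q v}
    {k : (Σ v, A v) → ℕ} (hk : ∀ b, (N.productionCount q).mulVec k b < N.resetNumber b * k b) :
    IsStrictlySubinvariant (N.productionMatrix q) fun a => (N.resetNumber a * k a : ℚ) where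
  nonneg a b := by
    rw [productionMatrix_apply]
    positivity
  pos a := by exact_mod_cast (Nat.zero_le _).trans_lt (hk a)
  mulVec_lt b := by
    rw [productionMatrix_mulVec]
    exact_mod_cast hk b

theorem det_laplacian_eq_iff (q : ∀ v, Q v) :
    (N.laplacian q).det = N.resetMatrix.det ↔ (1 - N.productionMatrix q).det = 1 := by
  have h : N.resetMatrix.det ≠ 0 := by
    rw [resetMatrix, Matrix.det_diagonal]
    exact Finset.prod_ne_zero_iff.2 fun a _ => Nat.cast_ne_zero.2 (N.resetNumber_ne_zero a)
  rw [laplacian, Matrix.det_mul, mul_eq_right₀ h]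

end AbelianNetwork

/-! ### The sandpilization -/

theorem sum_range_ite_add_one_eq_zero {M : Type*} [AddCommMonoid M] {n : ℕ} [NeZero n]
    (x : ZMod n) (c : M) : ∑ j ∈ Finset.range n, (if x + j + 1 = 0 then c else 0) = c := by
  rw [Finset.sum_eq_single (-(x + 1)).val]
  · rw [ZMod.natCast_zmod_val, if_pos (by ring)]
  · intro j hj hne
    refine if_neg fun h => hne ?_
    have hj' : (j : ZMod n) = -(x + 1) := by linear_combination h
    rw [← hj', ZMod.val_cast_of_lt (Finset.mem_range.1 hj)]
  · exact fun h => absurd (Finset.mem_range.2 (ZMod.val_lt _)) h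

namespace AbelianNetwork

variable {V : Type*} {A Q : V → Type*} [DecidableEq V] [∀ v, DecidableEq (A v)]
  (N : AbelianNetwork V A Q) (q : ∀ v, Q v)

theorem sandpileProcessor_run_replicate (a : Σ v, A v) (m : ℕ) (s : ZMod (N.resetNumber a)) :
    (N.sandpileProcessor q a).run (List.replicate m ()) s = s + m := by
  induction m generalizing s with
  | zero => exact (add_zero s).symm.trans (by rw [Nat.cast_zero])
  | succ m ih =>
    refine (ih (s + 1)).trans ?_
    push_cast
    ring

theorem sandpilization_run (w : List (Σ _ : (Σ v, A v), Unit))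
    (s : ∀ a, ZMod (N.resetNumber a)) (a : Σ v, A v) :
    (N.sandpilization q).localProcessor.run w s a = s a + w.count ⟨a, ()⟩ := by
  induction w generalizing s with
  | nil => simp [Processor.run]
  | cons b w ih =>
    obtain ⟨b, ⟨⟩⟩ := b
    rw [Processor.run, ih, List.count_cons]
    change Function.update s b (s b + 1) a + _ = _
    rcases eq_or_ne a b with rfl | hab
    · simp [add_assoc, add_comm]
    · simp [hab, hab.symm]

variable [∀ v, Finite (Q v)]

theorem sandpileProcessor_sent_singleton (a : Σ v, A v) (s : ZMod (N.resetNumber a))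
    (b : Σ v, A v) : (N.sandpileProcessor q a).sent [()] s ⟨b, ()⟩ =
      if s + 1 = 0 then N.productionCount q b a else 0 := by
  have hr : (N.resetNumber a : ℚ) ≠ 0 := Nat.cast_ne_zero.2 (N.resetNumber_ne_zero a)
  have hfloor : ⌊(N.resetNumber a : ℚ) * N.productionMatrix q b a⌋₊ = N.productionCount q b a := by
    rw [productionMatrix_apply, mul_div_cancel₀ _ hr, Nat.floor_natCast]
  simp only [Processor.sent, Processor.output, sandpileProcessor, hfloor, List.append_nil]
  split_ifs <;> simp

theorem sandpileProcessor_sent_replicate (a : Σ v, A v) (m : ℕ) (s : ZMod (N.resetNumber a))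
    (b : Σ v, A v) : (N.sandpileProcessor q a).sent (List.replicate m ()) s ⟨b, ()⟩ =
      ∑ j ∈ Finset.range m, if s + j + 1 = 0 then N.productionCount q b a else 0 := by
  induction m with
  | zero => rfl
  | succ m ih =>
    rw [List.replicate_succ', AbelianProcessor.sent_append, Pi.add_apply, ih,
      Finset.sum_range_succ, sandpileProcessor_sent_singleton, sandpileProcessor_run_replicate]

theorem isPeriodicOn_sandpilization :
    (N.sandpilization q).localProcessor.IsPeriodicOn Set.univ (fun a => N.resetNumber a.1)
      ((N.productionCount q).submatrix Sigma.fst Sigma.fst) := by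
  simpa only [Set.mem_univ, implies_true, Set.ofPred_true] using
    isPeriodicOn_localProcessor (N := N.sandpilization q) (S := fun _ => Set.univ) fun a =>
    have : NeZero (N.resetNumber a) := ⟨N.resetNumber_ne_zero a⟩
    { pos _ := N.one_le_resetNumber a
      t_mem _ _ _ := trivial
      run_replicate _ s _ := (N.sandpileProcessor_run_replicate q a _ s).trans (by simp)
      sent_replicate _ s _ := funext fun b =>
        (N.sandpileProcessor_sent_replicate q a _ s b.1).trans
          (sum_range_ite_add_one_eq_zero s _) }

variable {N q} [Fintype V] [∀ v, Fintype (A v)] {k : (Σ v, A v) → ℕ}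

theorem haltsOnAllInputs_sandpilization
    (hk : ∀ b, (N.productionCount q).mulVec k b < N.resetNumber b * k b) :
    (N.sandpilization q).HaltsOnAllInputs := by
  refine (N.isPeriodicOn_sandpilization q).haltsOnAllInputs (k := fun a => k a.1) fun b => ?_
  simpa [Matrix.mulVec, dotProduct, Fintype.sum_sigma] using hk b.1

/-- If the letters of a chordless cycle of the production graph are in state `-1` and all others
in state `0`, then processing the cycle once leads to the state `0`. -/
theorem wellFounded_of_isRecurrent_sandpilization_zero
    (hk : ∀ b, (N.productionCount q).mulVec k b < N.resetNumber b * k b)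
    (h : (N.sandpilization q).IsRecurrent 0) :
    WellFounded fun a b => 0 < N.productionCount q b a := by
  classical
  by_contra hwf
  obtain ⟨C, p, ⟨c, hc⟩, hp⟩ := exists_equiv_rel_iff_of_not_wellFounded hwf
  let s : ∀ a, ZMod (N.resetNumber a) := fun a => if a ∈ C then -1 else 0
  let C' : Finset (Σ _ : (Σ v, A v), Unit) := {a | a.1 ∈ C}
  have hrun : (N.sandpilization q).localProcessor.run C'.toList s = 0 := by
    funext a
    rw [sandpilization_run, C'.nodup_toList.count]
    by_cases ha : a ∈ C <;> simp [C', s, ha]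
  refine (N.isPeriodicOn_sandpilization q).not_isRecurrent_run_toList
    (haltsOnAllInputs_sandpilization hk) (Set.mem_univ s) (C := C')
    ⟨⟨c, ()⟩, by simpa [C'] using hc⟩ (fun b hb => ?_) (hrun ▸ h)
  let b' : C := ⟨b.1, by simpa [C'] using hb⟩
  refine ⟨⟨p b', ()⟩, by simp [C'], ?_⟩
  have hsent := N.sandpileProcessor_sent_singleton q (p b') (s (p b')) b'
  rw [if_pos (by simp [s])] at hsent
  exact ((hp _ b').2 rfl).trans_eq hsent.symm

end AbelianNetwork

theorem theorem3p21 {V : Type*} {A Q : V → Type*}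
    [DecidableEq V] [∀ v, DecidableEq (A v)]
    [Fintype V] [∀ v, Fintype (A v)] [∀ v, Finite (Q v)]
    (N : AbelianNetwork V A Q) (hirr : N.IsIrreducible) (hhalt : N.HaltsOnAllInputs)
    (q₀ : ∀ v, Q v) (hq₀ : N.IsLocallyRecurrent q₀) :
    List.TFAE [
      ∀ q, N.IsLocallyRecurrent q → N.IsRecurrent q,
      (N.laplacian q₀).det = N.resetMatrix.det,
      ∀ s, (N.sandpilization q₀).IsRecurrent s,
      (N.sandpilization q₀).IsRecurrent 0,
      ¬ (N.productionGraph q₀).HasDirectedCycle,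
      IsNilpotent (N.productionMatrix q₀)] := by
  have hper := AbelianNetwork.isPeriodicOn_isLocallyRecurrent hirr hq₀
  have hsand := N.isPeriodicOn_sandpilization q₀
  obtain ⟨k, hk⟩ := hper.exists_mulVec_lt ⟨q₀, hq₀⟩ hhalt
  have hP := AbelianNetwork.isStrictlySubinvariant_productionMatrix hk
  have hadj : (N.productionGraph q₀).Adj = fun a b => 0 < N.productionCount q₀ b a :=
    funext₂ fun a b => propext (N.productionMatrix_pos_iff q₀ a b)
  have (a : Σ v, A v) : NeZero (N.resetNumber a) := ⟨N.resetNumber_ne_zero a⟩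
  have (a : Σ v, A v) : Finite (ZMod (N.resetNumber a)) := inferInstance
  rw [N.det_laplacian_eq_iff, not_hasDirectedCycle_iff_wellFounded_adj]
  tfae_have 1 → 5 := fun h => hadj ▸ hper.wellFounded_of_isRecurrent ⟨q₀, hq₀⟩ hhalt h
  tfae_have 5 → 1 := fun h q hq => hper.isRecurrent hhalt (hadj ▸ h) hq
  tfae_have 5 → 3 := fun h s =>
    hsand.isRecurrent (AbelianNetwork.haltsOnAllInputs_sandpilization hk)
      (InvImage.wf Sigma.fst (hadj ▸ h)) (Set.mem_univ s)
  tfae_have 3 → 4 := fun h => h 0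
  tfae_have 4 → 5 := fun h =>
    hadj ▸ AbelianNetwork.wellFounded_of_isRecurrent_sandpilization_zero hk h
  tfae_have 5 → 6 := fun h => isNilpotent_of_wellFounded
    (h.mono fun a b hab => (hP.nonneg b a).lt_of_ne' hab)
  tfae_have 6 → 2 := det_one_sub_of_isNilpotent
  tfae_have 2 → 5 := hP.wellFounded_of_det_eq_one
  tfae_finish
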